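/- A \emph{birestriction monoid} is a monoid $S$ with two unary operations ${}^*,{}^+$ satisfying $xx^*=x$, $x^*y^*=y^*x^*$, $(xy^*)^*=x^*y^*$, $x^*y=y(xy)^*$, the dual identities $x^+x=x$, $x^+y^+=y^+x^+$, $(x^+y)^+=x^+y^+$, $xy^+=(xy)^+x$, and $(x^+)^*=x^+$, $(x^*)^+=x^*$; morphisms of birestriction monoids ($(2,1,1,0)$-morphisms) preserve $\cdot,{}^*,{}^+,1$. Its projections are the elements $s^*$; the natural partial order is given by $s\le t$ iff $s=et$ for some projection $e$, and $\sigma$ is the congruence with $s\mathrel\sigma t$ iff $es=et$ for some projection $e$. Every inverse monoid is a birestriction monoid via $x^*=x^{-1}x$, $x^+=xx^{-1}$; it is \emph{$E$-unitary} if every element above an idempotent in the natural partial order is an idempotent. For a set $Y$, a birestriction monoid (resp. an inverse monoid) $S$ with an assignment map $\iota\colon Y\to S$ is \emph{$Y$-generated} if it is generated by $\iota(Y)$ as a birestriction monoid (resp. as an inverse monoid). A $Y$-generated birestriction monoid $S$ \emph{admits a geometric model} if there are a $Y$-generated $E$-unitary inverse monoid $T$ and an injective morphism of birestriction monoids $S\to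 T$ which is compatible with the assignment maps of $S$ and $T$. An \emph{$F$-birestriction monoid} is a birestriction monoid in which every $\sigma$-class has a maximum element; $\mathfrak m(s)$ denotes the maximum element of the $\sigma$-class of $s$. It is \emph{perfect} if $[s]_\sigma\mapsto \mathfrak m(s)$ is a monoid morphism $S/\sigma\to S$. Let $\mathsf{FFBR}_p(X)$ be the free $X$-generated perfect $F$-birestriction monoid, in the signature $(\cdot,{}^*,{}^+,\mathfrak m,1)$. Let $X$ be a non-empty set, $X^+$ the free semigroup on $X$, and $\overline{X}$, $\overline{X^+}$ disjoint bijective copies of $X$ and $X^+$, respectively. Let $$F_p=\mathrm{BRestr}\langle X\cup\overline X\mid \overline x\ge x,\ x\in X\rangle,\qquad I_p=\mathrm{Inv}\langle X\cup\overline X\mid \overline x\ge x,\ x\in X\rangle,$$ $$\mathcal F_p=\mathrm{BRestr}\langle X\cup\overline{X^+}\mid \overline x\ge x,\ \overline{uv}=\overline u\,\overline v,\ x\in X,\ u,v\in X^+\rangle$$ be the birestriction monoids, respectively the inverse monoid, with these presentations, where $\overline x\ge x$ stands for the relation $x=\overline x\,x^*$ (that is, $x=\overline x\,x^{-1}x$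 in the inverse case). \textbf{Theorem.} The inverse monoid $I_p$ is $E$-unitary. The $(X\cup\overline X)$-generated birestriction monoid $F_p$ and the $(X\cup\overline{X^+})$-generated birestriction monoid $\mathcal F_p$ admit geometric models. Moreover, $\mathsf{FFBR}_p(X)$ is generated as a birestriction monoid by $X\cup\overline X$ via $x\mapsto x$, $\overline x\mapsto\mathfrak m(x)$, and by $X\cup\overline{X^+}$ via $x\mapsto x$, $\overline u\mapsto\mathfrak m(u)$, and it admits a geometric model with respect to each of these two assignment maps. -/

import Mathlib

universe u v w

/-- A birestriction monoid, an algebra of signature `(·, *, +, 1)`: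
`rst x` is `x^*` and `crst x` is `x^+`. -/
class BirestrictionMonoid (S : Type u) extends Monoid S where
  rst : S → S
  crst : S → S
  mul_rst : ∀ x : S, x * rst x = x
  rst_comm : ∀ x y : S, rst x * rst y = rst y * rst x
  rst_mul_rst : ∀ x y : S, rst (x * rst y) = rst x * rst y
  rst_mul : ∀ x y : S, rst x * y = y * rst (x * y)
  crst_mul : ∀ x : S, crst x * x = x
  crst_comm : ∀ x y : S, crst x * crst y = crst y * crst x
  crst_mul_crst : ∀ x y : S, crst (crst x * y) = crst x * crst y
  mul_crst : ∀ x y : S, x * crst y = crst (x * y) * x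
  rst_crst : ∀ x : S, rst (crst x) = crst x
  crst_rst : ∀ x : S, crst (rst x) = rst x

/-- Morphisms of birestriction monoids, i.e. `(2,1,1,0)`-morphisms. -/
structure BirestrictionHom (S : Type u) (T : Type v) [BirestrictionMonoid S]
    [BirestrictionMonoid T] extends S →* T where
  map_rst : ∀ s : S, toFun (BirestrictionMonoid.rst s) = BirestrictionMonoid.rst (toFun s)
  map_crst : ∀ s : S, toFun (BirestrictionMonoid.crst s) = BirestrictionMonoid.crst (toFun s)

namespace BirestrictionMonoid

/-- The projections of `S`: the elements of the form `s^*` (equivalently, of the form `s^+`). -/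
def IsProj {S : Type u} [BirestrictionMonoid S] (e : S) : Prop := ∃ s : S, e = rst s

/-- The natural partial order: `s ≤ t` iff `s = e t` for a projection `e`. -/
def NatLE {S : Type u} [BirestrictionMonoid S] (s t : S) : Prop :=
  ∃ e : S, IsProj e ∧ s = e * t

/-- The minimum congruence identifying all projections: `s σ t` iff `e s = e t`
for a projection `e`. -/
def Sigma {S : Type u} [BirestrictionMonoid S] (s t : S) : Prop :=
  ∃ e : S, IsProj e ∧ e * s = e * t

/-- `S` is `(2,1,1,0)`-generated by the image of the assignment map `ι`: the only subset of `S`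
that contains this image and `1` and is closed under `·`, `*`, `+` is `S`. -/
def IsGeneratedBy {Y : Type v} {S : Type u} [BirestrictionMonoid S] (ι : Y → S) : Prop :=
  ∀ A : Set S, (∀ y, ι y ∈ A) → 1 ∈ A → (∀ s ∈ A, ∀ t ∈ A, s * t ∈ A) →
    (∀ s ∈ A, rst s ∈ A) → (∀ s ∈ A, crst s ∈ A) → ∀ s, s ∈ A

variable {S : Type u} [BirestrictionMonoid S]

theorem IsProj.mul {e f : S} (he : IsProj e) (hf : IsProj f) : IsProj (e * f) := by
  obtain ⟨a, rfl⟩ := he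
  obtain ⟨b, rfl⟩ := hf
  exact ⟨a * rst b, (rst_mul_rst a b).symm⟩

theorem IsProj.comm {e f : S} (he : IsProj e) (hf : IsProj f) : e * f = f * e := by
  obtain ⟨a, rfl⟩ := he
  obtain ⟨b, rfl⟩ := hf
  exact rst_comm a b

theorem IsProj.idem {e : S} (he : IsProj e) : e * e = e := by
  obtain ⟨a, rfl⟩ := he
  rw [← rst_mul_rst, mul_rst]

theorem isProj_crst (a : S) : IsProj (crst a) := ⟨crst a, (rst_crst a).symm⟩

theorem mul_proj_eq (a : S) {f : S} (hf : IsProj f) : a * f = crst (a * f) * a := by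
  obtain ⟨b, rfl⟩ := hf
  have h := mul_crst a (rst b)
  rwa [crst_rst] at h

theorem rst_one : rst (1 : S) = 1 := by
  have := mul_rst (1 : S)
  rwa [one_mul] at this

theorem Sigma.trans {a b c : S} (h : Sigma a b) (h' : Sigma b c) : Sigma a c := by
  obtain ⟨e, he, h⟩ := h
  obtain ⟨f, hf, h'⟩ := h'
  refine ⟨e * f, he.mul hf, ?_⟩
  rw [he.comm hf, mul_assoc, h, ← mul_assoc, ← he.comm hf, mul_assoc, h', ← mul_assoc]

theorem NatLE.antisymm {a b : S} (h : NatLE a b) (h' : NatLE b a) : a = b := by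
  obtain ⟨e, he, h⟩ := h
  obtain ⟨f, hf, h'⟩ := h'
  have hea : e * a = a := by rw [h, ← mul_assoc, he.idem]
  calc a = e * (f * a) := by rw [← h']; exact h
    _ = f * (e * a) := by rw [← mul_assoc, he.comm hf, mul_assoc]
    _ = b := by rw [hea, ← h']

end BirestrictionMonoid

open BirestrictionMonoid in
/-- An `F`-birestriction monoid: every `σ`-class has a maximum element with respect to the natural
partial order; `mx s` is the maximum element of the `σ`-class of `s`. -/
class FBirestrictionMonoid (S : Type u) extends BirestrictionMonoid S where
  mx : S → S
  mx_sigma : ∀ s : S, Sigma (mx s) s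
  le_mx : ∀ s t : S, Sigma t s → NatLE t (mx s)

/-- A perfect `F`-birestriction monoid: the map `τ : S/σ → S`, `[s]_σ ↦ mx s`, is a morphism of
monoids. -/
class PerfectFBirestrictionMonoid (S : Type u) extends FBirestrictionMonoid S where
  mx_one : mx (1 : S) = 1
  mx_mul : ∀ s t : S, mx (s * t) = mx s * mx t

/-- An inverse monoid, given by the usual axioms of the variety of inverse monoids. -/
class InverseMonoid (S : Type u) extends Monoid S, Inv S where
  mul_inv_mul : ∀ x : S, x * x⁻¹ * x = x
  inv_inv' : ∀ x : S, x⁻¹⁻¹ = x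
  mul_inv : ∀ x y : S, (x * y)⁻¹ = y⁻¹ * x⁻¹
  comm : ∀ x y : S, x * x⁻¹ * (y * y⁻¹) = y * y⁻¹ * (x * x⁻¹)

namespace InverseMonoid

/-- `S` is generated, as an inverse monoid, by the image of the assignment map `ι`. -/
def IsGeneratedBy {Y : Type v} {S : Type u} [InverseMonoid S] (ι : Y → S) : Prop :=
  ∀ A : Set S, (∀ y, ι y ∈ A) → 1 ∈ A → (∀ s ∈ A, ∀ t ∈ A, s * t ∈ A) →
    (∀ s ∈ A, s⁻¹ ∈ A) → ∀ s, s ∈ A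

/-- `S` is `E`-unitary: an element above an idempotent in the natural partial order (`e ≤ s` iff
`e = f s` for an idempotent `f`) is an idempotent. -/
def IsEUnitary (S : Type u) [InverseMonoid S] : Prop :=
  ∀ e f s : S, IsIdempotentElem e → IsIdempotentElem f → e = f * s → IsIdempotentElem s

variable {S : Type u} [InverseMonoid S]

theorem comm' (x y : S) : x⁻¹ * x * (y⁻¹ * y) = y⁻¹ * y * (x⁻¹ * x) := by
  have := comm x⁻¹ y⁻¹
  simpa only [inv_inv'] using this

theorem comm'' (x y : S) : x * x⁻¹ * (y⁻¹ * y) = y⁻¹ * y * (x * x⁻¹) := by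
  have := comm x y⁻¹
  simpa only [inv_inv'] using this

theorem inv_mul_inv (x : S) : x⁻¹ * x * x⁻¹ = x⁻¹ := by
  have := mul_inv_mul x⁻¹
  rwa [inv_inv'] at this

/-- Every inverse monoid is a birestriction monoid with `x^* = x⁻¹ x` and `x^+ = x x⁻¹`. -/
instance toBirestrictionMonoid : BirestrictionMonoid S where
  rst x := x⁻¹ * x
  crst x := x * x⁻¹
  mul_rst x := by rw [← mul_assoc, mul_inv_mul]
  rst_comm := comm'
  rst_mul_rst x y := by
    calc (x * (y⁻¹ * y))⁻¹ * (x * (y⁻¹ * y))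
        = y⁻¹ * y * (x⁻¹ * x) * (y⁻¹ * y) := by simp only [mul_inv, inv_inv', mul_assoc]
      _ = x⁻¹ * x * (y⁻¹ * y * y⁻¹ * y) := by rw [comm' y x]; simp only [mul_assoc]
      _ = x⁻¹ * x * (y⁻¹ * y) := by rw [inv_mul_inv]
  rst_mul x y := by
    calc x⁻¹ * x * y = x⁻¹ * x * (y * y⁻¹ * y) := by rw [mul_inv_mul]
      _ = y * y⁻¹ * (x⁻¹ * x) * y := by rw [comm'' y x]; simp only [mul_assoc]
      _ = y * ((x * y)⁻¹ * (x * y)) := by simp only [mul_inv, mul_assoc]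
  crst_mul := mul_inv_mul
  crst_comm := comm
  crst_mul_crst x y := by
    calc x * x⁻¹ * y * (x * x⁻¹ * y)⁻¹
        = x * x⁻¹ * (y * y⁻¹ * (x * x⁻¹)) := by simp only [mul_inv, inv_inv', mul_assoc]
      _ = x * x⁻¹ * x * x⁻¹ * (y * y⁻¹) := by rw [← comm x y]; simp only [mul_assoc]
      _ = x * x⁻¹ * (y * y⁻¹) := by rw [mul_inv_mul]
  mul_crst x y := by
    calc x * (y * y⁻¹) = x * x⁻¹ * x * (y * y⁻¹) := by rw [mul_inv_mul]
      _ = x * (x⁻¹ * x * (y * y⁻¹)) := by simp only [mul_assoc]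
      _ = x * y * (x * y)⁻¹ * x := by rw [← comm'' y x]; simp only [mul_inv, mul_assoc]
  rst_crst x := by
    calc (x * x⁻¹)⁻¹ * (x * x⁻¹) = x * x⁻¹ * x * x⁻¹ := by
          simp only [mul_inv, inv_inv', mul_assoc]
      _ = x * x⁻¹ := by rw [mul_inv_mul]
  crst_rst x := by
    calc x⁻¹ * x * (x⁻¹ * x)⁻¹ = x⁻¹ * x * x⁻¹ * x := by
          simp only [mul_inv, inv_inv', mul_assoc]
      _ = x⁻¹ * x := by rw [inv_mul_inv]

end InverseMonoid

/-- The `Y`-generated birestriction monoid `S` (with assignment map `ι`) admits a geometric model: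
it canonically `(2,1,1,0)`-embeds into a `Y`-generated `E`-unitary inverse monoid. -/
def AdmitsGeometricModel {Y S : Type u} [BirestrictionMonoid S] (ι : Y → S) : Prop :=
  BirestrictionMonoid.IsGeneratedBy ι ∧
  ∃ (T : Type u) (_ : InverseMonoid T) (j : Y → T) (f : BirestrictionHom S T),
    InverseMonoid.IsGeneratedBy j ∧ InverseMonoid.IsEUnitary T ∧
    Function.Injective f.toFun ∧ ∀ y, f.toFun (ι y) = j y

/-! ### Presentations of birestriction monoids -/

/-- Terms over `Y` in the signature of birestriction monoids. -/
inductive BRTerm (Y : Type u) : Type u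
  | var : Y → BRTerm Y
  | one : BRTerm Y
  | mul : BRTerm Y → BRTerm Y → BRTerm Y
  | rst : BRTerm Y → BRTerm Y
  | crst : BRTerm Y → BRTerm Y

/-- The least `(2,1,1,0)`-congruence on terms that contains the relations `R` and all instances of
the identities of birestriction monoids. -/
inductive BRCongr {Y : Type u} (R : BRTerm Y → BRTerm Y → Prop) : BRTerm Y → BRTerm Y → Prop
  | rel {a b : BRTerm Y} : R a b → BRCongr R a b
  | refl (a : BRTerm Y) : BRCongr R a a
  | symm {a b : BRTerm Y} : BRCongr R a b → BRCongr R b a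
  | trans {a b c : BRTerm Y} : BRCongr R a b → BRCongr R b c → BRCongr R a c
  | mul {a b c d : BRTerm Y} : BRCongr R a b → BRCongr R c d → BRCongr R (a.mul c) (b.mul d)
  | rst {a b : BRTerm Y} : BRCongr R a b → BRCongr R a.rst b.rst
  | crst {a b : BRTerm Y} : BRCongr R a b → BRCongr R a.crst b.crst
  | mul_assoc (x y z : BRTerm Y) : BRCongr R ((x.mul y).mul z) (x.mul (y.mul z))
  | one_mul (x : BRTerm Y) : BRCongr R (BRTerm.one.mul x) x
  | mul_one (x : BRTerm Y) : BRCongr R (x.mul BRTerm.one) x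
  | mul_rst (x : BRTerm Y) : BRCongr R (x.mul x.rst) x
  | rst_comm (x y : BRTerm Y) : BRCongr R (x.rst.mul y.rst) (y.rst.mul x.rst)
  | rst_mul_rst (x y : BRTerm Y) : BRCongr R (x.mul y.rst).rst (x.rst.mul y.rst)
  | rst_mul (x y : BRTerm Y) : BRCongr R (x.rst.mul y) (y.mul (x.mul y).rst)
  | crst_mul (x : BRTerm Y) : BRCongr R (x.crst.mul x) x
  | crst_comm (x y : BRTerm Y) : BRCongr R (x.crst.mul y.crst) (y.crst.mul x.crst)
  | crst_mul_crst (x y : BRTerm Y) : BRCongr R (x.crst.mul y).crst (x.crst.mul y.crst)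
  | mul_crst (x y : BRTerm Y) : BRCongr R (x.mul y.crst) ((x.mul y).crst.mul x)
  | rst_crst (x : BRTerm Y) : BRCongr R x.crst.rst x.crst
  | crst_rst (x : BRTerm Y) : BRCongr R x.rst.crst x.rst

/-- The term congruence as a setoid. -/
def BRSetoid {Y : Type u} (R : BRTerm Y → BRTerm Y → Prop) : Setoid (BRTerm Y) :=
  ⟨BRCongr R, BRCongr.refl, BRCongr.symm, BRCongr.trans⟩

/-- The birestriction monoid `BRestr⟨Y | R⟩` generated by `Y` subject to the relations `R`. -/
def BRestr {Y : Type u} (R : BRTerm Y → BRTerm Y → Prop) : Type u := Quotient (BRSetoid R)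

namespace BRestr

variable {Y : Type u} {R : BRTerm Y → BRTerm Y → Prop}

instance : BirestrictionMonoid (BRestr R) where
  mul := Quotient.map₂ BRTerm.mul fun _ _ h _ _ h' => BRCongr.mul h h'
  one := Quotient.mk (BRSetoid R) BRTerm.one
  rst := Quotient.map BRTerm.rst fun _ _ h => BRCongr.rst h
  crst := Quotient.map BRTerm.crst fun _ _ h => BRCongr.crst h
  mul_assoc := by rintro ⟨x⟩ ⟨y⟩ ⟨z⟩; exact Quotient.sound (BRCongr.mul_assoc x y z)
  one_mul := by rintro ⟨x⟩; exact Quotient.sound (BRCongr.one_mul x)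
  mul_one := by rintro ⟨x⟩; exact Quotient.sound (BRCongr.mul_one x)
  mul_rst := by rintro ⟨x⟩; exact Quotient.sound (BRCongr.mul_rst x)
  rst_comm := by rintro ⟨x⟩ ⟨y⟩; exact Quotient.sound (BRCongr.rst_comm x y)
  rst_mul_rst := by rintro ⟨x⟩ ⟨y⟩; exact Quotient.sound (BRCongr.rst_mul_rst x y)
  rst_mul := by rintro ⟨x⟩ ⟨y⟩; exact Quotient.sound (BRCongr.rst_mul x y)
  crst_mul := by rintro ⟨x⟩; exact Quotient.sound (BRCongr.crst_mul x)
  crst_comm := by rintro ⟨x⟩ ⟨y⟩; exact Quotient.sound (BRCongr.crst_comm x y)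
  crst_mul_crst := by rintro ⟨x⟩ ⟨y⟩; exact Quotient.sound (BRCongr.crst_mul_crst x y)
  mul_crst := by rintro ⟨x⟩ ⟨y⟩; exact Quotient.sound (BRCongr.mul_crst x y)
  rst_crst := by rintro ⟨x⟩; exact Quotient.sound (BRCongr.rst_crst x)
  crst_rst := by rintro ⟨x⟩; exact Quotient.sound (BRCongr.crst_rst x)

/-- The canonical assignment map `Y → BRestr⟨Y | R⟩`. -/
def of (R : BRTerm Y → BRTerm Y → Prop) (y : Y) : BRestr R :=
  Quotient.mk (BRSetoid R) (BRTerm.var y)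

end BRestr

/-! ### Presentations of inverse monoids -/

/-- Terms over `Y` in the signature of inverse monoids. -/
inductive InvTerm (Y : Type u) : Type u
  | var : Y → InvTerm Y
  | one : InvTerm Y
  | mul : InvTerm Y → InvTerm Y → InvTerm Y
  | inv : InvTerm Y → InvTerm Y

/-- The least congruence on terms that contains the relations `R` and all instances of the
identities of inverse monoids. -/
inductive InvCongr {Y : Type u} (R : InvTerm Y → InvTerm Y → Prop) : InvTerm Y → InvTerm Y → Prop
  | rel {a b : InvTerm Y} : R a b → InvCongr R a b
  | refl (a : InvTerm Y) : InvCongr R a a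
  | symm {a b : InvTerm Y} : InvCongr R a b → InvCongr R b a
  | trans {a b c : InvTerm Y} : InvCongr R a b → InvCongr R b c → InvCongr R a c
  | mul {a b c d : InvTerm Y} : InvCongr R a b → InvCongr R c d → InvCongr R (a.mul c) (b.mul d)
  | inv {a b : InvTerm Y} : InvCongr R a b → InvCongr R a.inv b.inv
  | mul_assoc (x y z : InvTerm Y) : InvCongr R ((x.mul y).mul z) (x.mul (y.mul z))
  | one_mul (x : InvTerm Y) : InvCongr R (InvTerm.one.mul x) x
  | mul_one (x : InvTerm Y) : InvCongr R (x.mul InvTerm.one) x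
  | mul_inv_mul (x : InvTerm Y) : InvCongr R ((x.mul x.inv).mul x) x
  | inv_inv (x : InvTerm Y) : InvCongr R x.inv.inv x
  | mul_inv (x y : InvTerm Y) : InvCongr R (x.mul y).inv (y.inv.mul x.inv)
  | comm (x y : InvTerm Y) : InvCongr R ((x.mul x.inv).mul (y.mul y.inv)) ((y.mul y.inv).mul (x.mul x.inv))

/-- The term congruence as a setoid. -/
def InvSetoid {Y : Type u} (R : InvTerm Y → InvTerm Y → Prop) : Setoid (InvTerm Y) :=
  ⟨InvCongr R, InvCongr.refl, InvCongr.symm, InvCongr.trans⟩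

/-- The inverse monoid `Inv⟨Y | R⟩` generated by `Y` subject to the relations `R`. -/
def InvPres {Y : Type u} (R : InvTerm Y → InvTerm Y → Prop) : Type u := Quotient (InvSetoid R)

instance InvPres.instInverseMonoid {Y : Type u} {R : InvTerm Y → InvTerm Y → Prop} :
    InverseMonoid (InvPres R) where
  mul := Quotient.map₂ InvTerm.mul fun _ _ h _ _ h' => InvCongr.mul h h'
  one := Quotient.mk (InvSetoid R) InvTerm.one
  inv := Quotient.map InvTerm.inv fun _ _ h => InvCongr.inv h
  mul_assoc := by rintro ⟨x⟩ ⟨y⟩ ⟨z⟩; exact Quotient.sound (InvCongr.mul_assoc x y z)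
  one_mul := by rintro ⟨x⟩; exact Quotient.sound (InvCongr.one_mul x)
  mul_one := by rintro ⟨x⟩; exact Quotient.sound (InvCongr.mul_one x)
  mul_inv_mul := by rintro ⟨x⟩; exact Quotient.sound (InvCongr.mul_inv_mul x)
  inv_inv' := by rintro ⟨x⟩; exact Quotient.sound (InvCongr.inv_inv x)
  mul_inv := by rintro ⟨x⟩ ⟨y⟩; exact Quotient.sound (InvCongr.mul_inv x y)
  comm := by rintro ⟨x⟩ ⟨y⟩; exact Quotient.sound (InvCongr.comm x y)

/-! ### The monoids `F_p`, `𝓕_p` and `I_p`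

In `X ⊕ X` and in `X ⊕ FreeSemigroup X` the left summand is `X`, and the right summand is the
disjoint bijective copy `X̄`, respectively the disjoint bijective copy of the free semigroup. -/

/-- The relations `x̄ ≥ x`, i.e. `x = x̄ x^*`, over `X ∪ X̄`. -/
inductive FpRel (X : Type u) : BRTerm (X ⊕ X) → BRTerm (X ⊕ X) → Prop
  | ge (x : X) : FpRel X (.var (.inl x)) (.mul (.var (.inr x)) (.rst (.var (.inl x))))

/-- `F_p = BRestr⟨X ∪ X̄ | x̄ ≥ x, x ∈ X⟩`. -/
abbrev Fp (X : Type u) : Type u := BRestr (FpRel X)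

/-- The relations `x̄ ≥ x` for `x ∈ X`, and `\overline{uv} = ū v̄` for `u, v ∈ X⁺`, over
`X ∪ \overline{X⁺}`. -/
inductive CalFpRel (X : Type u) :
    BRTerm (X ⊕ FreeSemigroup X) → BRTerm (X ⊕ FreeSemigroup X) → Prop
  | ge (x : X) : CalFpRel X (.var (.inl x))
      (.mul (.var (.inr (FreeSemigroup.of x))) (.rst (.var (.inl x))))
  | mul (p q : FreeSemigroup X) : CalFpRel X (.var (.inr (p * q)))
      (.mul (.var (.inr p)) (.var (.inr q)))

/-- `𝓕_p = BRestr⟨X ∪ \overline{X⁺} | x̄ ≥ x, \overline{uv} = ū v̄⟩`. -/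
abbrev CalFp (X : Type u) : Type u := BRestr (CalFpRel X)

/-- The relations `x̄ ≥ x`, i.e. `x = x̄ (x⁻¹ x)`, over `X ∪ X̄`. -/
inductive IpRel (X : Type u) : InvTerm (X ⊕ X) → InvTerm (X ⊕ X) → Prop
  | ge (x : X) : IpRel X (.var (.inl x))
      (.mul (.var (.inr x)) (.mul (.inv (.var (.inl x))) (.var (.inl x))))

/-- `I_p = Inv⟨X ∪ X̄ | x̄ ≥ x, x ∈ X⟩`. -/
abbrev Ip (X : Type u) : Type u := InvPres (IpRel X)

/-! ### The free perfect `F`-birestriction monoid -/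

/-- Terms over `X` in the signature `(·, *, +, mx, 1)`. -/
inductive FTerm (X : Type u) : Type u
  | var : X → FTerm X
  | one : FTerm X
  | mul : FTerm X → FTerm X → FTerm X
  | rst : FTerm X → FTerm X
  | crst : FTerm X → FTerm X
  | mx : FTerm X → FTerm X

/-- The least `(2,1,1,1,0)`-congruence on terms that contains all instances of the identities of
birestriction monoids and of `mx(a) a^* = a`, `mx(a b^*) = mx(a)`, `mx(a) mx(b) = mx(a b)`, which
define the variety of perfect `F`-birestriction monoids. -/
inductive FTermCongr {X : Type u} : FTerm X → FTerm X → Prop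
  | refl (a : FTerm X) : FTermCongr a a
  | symm {a b : FTerm X} : FTermCongr a b → FTermCongr b a
  | trans {a b c : FTerm X} : FTermCongr a b → FTermCongr b c → FTermCongr a c
  | mul {a b c d : FTerm X} : FTermCongr a b → FTermCongr c d → FTermCongr (a.mul c) (b.mul d)
  | rst {a b : FTerm X} : FTermCongr a b → FTermCongr a.rst b.rst
  | crst {a b : FTerm X} : FTermCongr a b → FTermCongr a.crst b.crst
  | mx {a b : FTerm X} : FTermCongr a b → FTermCongr a.mx b.mx
  | mul_assoc (x y z : FTerm X) : FTermCongr ((x.mul y).mul z) (x.mul (y.mul z))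
  | one_mul (x : FTerm X) : FTermCongr (FTerm.one.mul x) x
  | mul_one (x : FTerm X) : FTermCongr (x.mul FTerm.one) x
  | mul_rst (x : FTerm X) : FTermCongr (x.mul x.rst) x
  | rst_comm (x y : FTerm X) : FTermCongr (x.rst.mul y.rst) (y.rst.mul x.rst)
  | rst_mul_rst (x y : FTerm X) : FTermCongr (x.mul y.rst).rst (x.rst.mul y.rst)
  | rst_mul (x y : FTerm X) : FTermCongr (x.rst.mul y) (y.mul (x.mul y).rst)
  | crst_mul (x : FTerm X) : FTermCongr (x.crst.mul x) x
  | crst_comm (x y : FTerm X) : FTermCongr (x.crst.mul y.crst) (y.crst.mul x.crst)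
  | crst_mul_crst (x y : FTerm X) : FTermCongr (x.crst.mul y).crst (x.crst.mul y.crst)
  | mul_crst (x y : FTerm X) : FTermCongr (x.mul y.crst) ((x.mul y).crst.mul x)
  | rst_crst (x : FTerm X) : FTermCongr x.crst.rst x.crst
  | crst_rst (x : FTerm X) : FTermCongr x.rst.crst x.rst
  | mx_mul_rst (x : FTerm X) : FTermCongr (x.mx.mul x.rst) x
  | mx_rst (x y : FTerm X) : FTermCongr (x.mul y.rst).mx x.mx
  | mx_mul (x y : FTerm X) : FTermCongr (x.mx.mul y.mx) (x.mul y).mx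

/-- The term congruence as a setoid. -/
def FTermSetoid (X : Type u) : Setoid (FTerm X) :=
  ⟨FTermCongr, FTermCongr.refl, FTermCongr.symm, FTermCongr.trans⟩

/-- The free perfect `F`-birestriction monoid `FFBR_p(X)`. -/
def FFBRp (X : Type u) : Type u := Quotient (FTermSetoid X)

namespace FFBRp

variable {X : Type u}

instance : BirestrictionMonoid (FFBRp X) where
  mul := Quotient.map₂ FTerm.mul fun _ _ h _ _ h' => FTermCongr.mul h h'
  one := Quotient.mk (FTermSetoid X) FTerm.one
  rst := Quotient.map FTerm.rst fun _ _ h => FTermCongr.rst h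
  crst := Quotient.map FTerm.crst fun _ _ h => FTermCongr.crst h
  mul_assoc := by rintro ⟨x⟩ ⟨y⟩ ⟨z⟩; exact Quotient.sound (FTermCongr.mul_assoc x y z)
  one_mul := by rintro ⟨x⟩; exact Quotient.sound (FTermCongr.one_mul x)
  mul_one := by rintro ⟨x⟩; exact Quotient.sound (FTermCongr.mul_one x)
  mul_rst := by rintro ⟨x⟩; exact Quotient.sound (FTermCongr.mul_rst x)
  rst_comm := by rintro ⟨x⟩ ⟨y⟩; exact Quotient.sound (FTermCongr.rst_comm x y)
  rst_mul_rst := by rintro ⟨x⟩ ⟨y⟩; exact Quotient.sound (FTermCongr.rst_mul_rst x y)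
  rst_mul := by rintro ⟨x⟩ ⟨y⟩; exact Quotient.sound (FTermCongr.rst_mul x y)
  crst_mul := by rintro ⟨x⟩; exact Quotient.sound (FTermCongr.crst_mul x)
  crst_comm := by rintro ⟨x⟩ ⟨y⟩; exact Quotient.sound (FTermCongr.crst_comm x y)
  crst_mul_crst := by rintro ⟨x⟩ ⟨y⟩; exact Quotient.sound (FTermCongr.crst_mul_crst x y)
  mul_crst := by rintro ⟨x⟩ ⟨y⟩; exact Quotient.sound (FTermCongr.mul_crst x y)
  rst_crst := by rintro ⟨x⟩; exact Quotient.sound (FTermCongr.rst_crst x)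
  crst_rst := by rintro ⟨x⟩; exact Quotient.sound (FTermCongr.crst_rst x)

open BirestrictionMonoid

/-- The operation `mx` on `FFBR_p(X)`. -/
def mxOp : FFBRp X → FFBRp X := Quotient.map FTerm.mx fun _ _ h => FTermCongr.mx h

theorem mxOp_mul_rst (a : FFBRp X) : mxOp a * rst a = a := by
  induction a using Quotient.inductionOn with
  | h x => exact Quotient.sound (FTermCongr.mx_mul_rst x)

theorem mxOp_rst (a b : FFBRp X) : mxOp (a * rst b) = mxOp a := by
  induction a using Quotient.inductionOn with
  | h x =>
    induction b using Quotient.inductionOn with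
    | h y => exact Quotient.sound (FTermCongr.mx_rst x y)

theorem mxOp_mul (a b : FFBRp X) : mxOp a * mxOp b = mxOp (a * b) := by
  induction a using Quotient.inductionOn with
  | h x =>
    induction b using Quotient.inductionOn with
    | h y => exact Quotient.sound (FTermCongr.mx_mul x y)

theorem eq_crst_mul_mxOp (a : FFBRp X) : a = crst a * mxOp a := by
  have h := mul_proj_eq (mxOp a) ⟨a, rfl⟩
  rwa [mxOp_mul_rst] at h

theorem mxOp_eq_of_sigma {a b : FFBRp X} (h : Sigma a b) : mxOp a = mxOp b := by
  obtain ⟨e, ⟨c, rfl⟩, h⟩ := h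
  rw [rst_mul, rst_mul] at h
  rw [← mxOp_rst a (c * a), h, mxOp_rst]

/-- `FFBR_p(X)` is a perfect `F`-birestriction monoid. -/
instance : PerfectFBirestrictionMonoid (FFBRp X) where
  mx := mxOp
  mx_sigma a := ⟨crst a, isProj_crst a, by rw [← eq_crst_mul_mxOp, crst_mul]⟩
  le_mx a b h := ⟨crst b, isProj_crst b, by rw [← mxOp_eq_of_sigma h]; exact eq_crst_mul_mxOp b⟩
  mx_one := by
    have h := mxOp_mul_rst (1 : FFBRp X)
    rwa [rst_one, mul_one] at h
  mx_mul a b := (mxOp_mul a b).symm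

/-- The canonical assignment map `X → FFBR_p(X)`. -/
def of (x : X) : FFBRp X := Quotient.mk (FTermSetoid X) (FTerm.var x)

/-- The assignment map `X ∪ X̄ → FFBR_p(X)`, `x ↦ x`, `x̄ ↦ mx(x)`. -/
def assign : X ⊕ X → FFBRp X :=
  Sum.elim of fun x => FBirestrictionMonoid.mx (of x)

/-- The assignment map `X ∪ \overline{X⁺} → FFBR_p(X)`, `x ↦ x`, `ū ↦ mx(u)`. -/
def assignPlus : X ⊕ FreeSemigroup X → FFBRp X :=
  Sum.elim of fun p => FBirestrictionMonoid.mx (FreeSemigroup.lift of p)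

/-! The universal property of `FFBR_p(X)`. -/

section Lift

variable {S : Type w} [PerfectFBirestrictionMonoid S]

open FBirestrictionMonoid PerfectFBirestrictionMonoid

theorem mx_eq_of_sigma {a b : S} (h : Sigma a b) : mx a = mx b := by
  have h' : Sigma b a := by
    obtain ⟨e, he, h⟩ := h
    exact ⟨e, he, h.symm⟩
  exact NatLE.antisymm (le_mx _ _ ((mx_sigma a).trans h)) (le_mx _ _ ((mx_sigma b).trans h'))

theorem mx_mul_rst (a : S) : mx a * rst a = a := by
  obtain ⟨e, ⟨c, rfl⟩, h⟩ := le_mx a a ⟨rst a, ⟨a, rfl⟩, rfl⟩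
  rw [rst_mul] at h
  have h2 : rst a = rst (mx a) * rst (c * mx a) := by
    conv_lhs => rw [h]
    rw [rst_mul_rst]
  rw [h2, ← mul_assoc, mul_rst, ← h]

theorem mx_rst (a b : S) : mx (a * rst b) = mx a := by
  refine mx_eq_of_sigma ⟨crst (a * rst b), isProj_crst _, ?_⟩
  rw [← mul_proj_eq a ⟨b, rfl⟩, crst_mul]

/-- The value of a term under an assignment. -/
def eval (g : X → S) : FTerm X → S
  | .var x => g x
  | .one => 1
  | .mul a b => eval g a * eval g b
  | .rst a => rst (eval g a)
  | .crst a => crst (eval g a)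
  | .mx a => mx (eval g a)

theorem eval_congr (g : X → S) {a b : FTerm X} (h : FTermCongr a b) : eval g a = eval g b := by
  induction h with
  | refl => rfl
  | symm _ ih => exact ih.symm
  | trans _ _ ih ih' => exact ih.trans ih'
  | mul _ _ ih ih' => simp only [eval, ih, ih']
  | rst _ ih => simp only [eval, ih]
  | crst _ ih => simp only [eval, ih]
  | mx _ ih => simp only [eval, ih]
  | mul_assoc => exact mul_assoc _ _ _
  | one_mul => exact one_mul _
  | mul_one => exact mul_one _
  | mul_rst => exact BirestrictionMonoid.mul_rst _
  | rst_comm => exact BirestrictionMonoid.rst_comm _ _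
  | rst_mul_rst => exact BirestrictionMonoid.rst_mul_rst _ _
  | rst_mul => exact BirestrictionMonoid.rst_mul _ _
  | crst_mul => exact BirestrictionMonoid.crst_mul _
  | crst_comm => exact BirestrictionMonoid.crst_comm _ _
  | crst_mul_crst => exact BirestrictionMonoid.crst_mul_crst _ _
  | mul_crst => exact BirestrictionMonoid.mul_crst _ _
  | rst_crst => exact BirestrictionMonoid.rst_crst _
  | crst_rst => exact BirestrictionMonoid.crst_rst _
  | mx_mul_rst => exact mx_mul_rst _
  | mx_rst => exact mx_rst _ _
  | mx_mul => exact (mx_mul _ _).symm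

/-- `FFBR_p(X)` is free: every map from `X` to a perfect `F`-birestriction monoid extends to a
unique `(2,1,1,1,0)`-morphism. -/
theorem existsUnique_lift (g : X → S) :
    ∃! f : BirestrictionHom (FFBRp X) S,
      (∀ a, f.toFun (mx a) = mx (f.toFun a)) ∧ ∀ x, f.toFun (of x) = g x := by
  refine ⟨{ toFun := Quotient.lift (eval g) fun _ _ h => eval_congr g h
            map_one' := rfl
            map_mul' := by rintro ⟨a⟩ ⟨b⟩; rfl
            map_rst := by rintro ⟨a⟩; rfl
            map_crst := by rintro ⟨a⟩; rfl }, ⟨by rintro ⟨a⟩; rfl, fun _ => rfl⟩, ?_⟩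
  rintro ⟨f, hr, hc⟩ ⟨hm, hx⟩
  have key : ∀ t : FTerm X, f (Quotient.mk (FTermSetoid X) t) = eval g t := by
    intro t
    induction t with
    | var x => exact hx x
    | one => exact f.map_one
    | mul a b iha ihb =>
      exact (f.map_mul (Quotient.mk (FTermSetoid X) a) (Quotient.mk (FTermSetoid X) b)).trans
        (by rw [iha, ihb]; rfl)
    | rst a ih => exact (hr (Quotient.mk (FTermSetoid X) a)).trans (congrArg rst ih)
    | crst a ih => exact (hc (Quotient.mk (FTermSetoid X) a)).trans (congrArg crst ih)
    | mx a ih => exact (hm (Quotient.mk (FTermSetoid X) a)).trans (congrArg mx ih)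
  congr 1
  ext a
  induction a using Quotient.inductionOn with
  | h t => exact key t

end Lift

end FFBRp

/-! One inverse monoid, `Ip X`, with suitable assignment maps, serves as geometric model in all four
cases.

It is E-unitary because each element lies below a word in the barred letters and their inverses. If
the element maps to 1 in the free group, this word reduces to the empty word; each reduction step
goes up in the natural order, so the element lies below 1 and is a projection
(`Ip.isProj_of_toFreeGroup_eq_one`).

To embed `Fp X`, write an element as s = s⁺ · bar(w), where w in the free monoid is its σ-class.
Both ingredients survive in `Ip X`: w is recovered from the free group, which contains the free
monoid, and s⁺ is recovered from the Munn representation of `Fp X`. The latter takes values in a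
symmetric inverse monoid, hence factors through `Ip X`, and it separates projections
(`Fp.toIp_injective`).

The elements bar(w) are the maxima of the σ-classes and are closed under products, so `Fp X` is
itself a perfect F-birestriction monoid. The universal property then maps `FFBRp X` into it, with a
left inverse; the same is done for `CalFp X` by expanding barred words into barred letters. These
embeddings transfer the model (`AdmitsGeometricModel.of_retraction`). -/

namespace BirestrictionMonoid

/-! ### Projections and the natural partial order. -/

variable {S : Type u} [BirestrictionMonoid S]

theorem isProj_rst (a : S) : IsProj (rst a) := ⟨a, rfl⟩

theorem isProj_one : IsProj (1 : S) := ⟨1, rst_one.symm⟩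

theorem crst_one : crst (1 : S) = 1 := by
  have := crst_mul (1 : S)
  rwa [mul_one] at this

theorem IsProj.rst_eq {e : S} (he : IsProj e) : rst e = e := by
  obtain ⟨a, rfl⟩ := he
  have := rst_mul_rst (1 : S) a
  rwa [one_mul, rst_one, one_mul] at this

theorem IsProj.crst_eq {e : S} (he : IsProj e) : crst e = e := by
  obtain ⟨a, rfl⟩ := he
  exact crst_rst a

theorem IsProj.crst_mul_eq {e : S} (he : IsProj e) (a : S) : crst (e * a) = e * crst a := by
  have := crst_mul_crst e a
  rwa [he.crst_eq] at this

theorem IsProj.rst_mul_eq {e : S} (he : IsProj e) (a : S) : rst (a * e) = rst a * e := by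
  have := rst_mul_rst a e
  rwa [he.rst_eq] at this

theorem IsProj.mul_eq {e : S} (he : IsProj e) (a : S) : e * a = a * rst (e * a) := by
  have := rst_mul e a
  rwa [he.rst_eq] at this

/-- Each of ab and a^*b is fixed on the right by the star of the other, so the two stars lie below
each other. -/
theorem rst_mul_eq_rst_rst_mul (a b : S) : rst (a * b) = rst (rst a * b) := by
  have h : a * b * rst (rst a * b) = a * b := by
    rw [mul_assoc, ← (isProj_rst a).mul_eq, ← mul_assoc, mul_rst]
  have h' : rst a * b * rst (a * b) = rst a * b := by
    rw [rst_mul, mul_assoc, (isProj_rst _).idem]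
  have h1 := rst_mul_rst (a * b) (rst a * b)
  have h2 := rst_mul_rst (rst a * b) (a * b)
  rw [h] at h1
  rw [h'] at h2
  rw [h1, rst_comm, ← h2]

theorem crst_mul_eq_crst_mul_crst (a b : S) : crst (a * b) = crst (a * crst b) := by
  have h : crst (a * crst b) * (a * b) = a * b := by
    rw [← mul_assoc, ← mul_proj_eq a (isProj_crst b), mul_assoc, crst_mul]
  have h' : crst (a * b) * (a * crst b) = a * crst b := by
    rw [mul_crst, ← mul_assoc, (isProj_crst _).idem]
  have h1 := crst_mul_crst (a * crst b) (a * b)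
  have h2 := crst_mul_crst (a * b) (a * crst b)
  rw [h] at h1
  rw [h'] at h2
  rw [h1, crst_comm, ← h2]

theorem NatLE.refl (a : S) : NatLE a a := ⟨1, isProj_one, (one_mul a).symm⟩

theorem NatLE.trans {a b c : S} (h : NatLE a b) (h' : NatLE b c) : NatLE a c := by
  obtain ⟨e, he, rfl⟩ := h
  obtain ⟨f, hf, rfl⟩ := h'
  exact ⟨e * f, he.mul hf, (mul_assoc _ _ _).symm⟩

/-- The inner projection is moved to the left through b by bf = (bf)⁺b. -/
theorem NatLE.mul {a b c d : S} (h : NatLE a b) (h' : NatLE c d) : NatLE (a * c) (b * d) := by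
  obtain ⟨e, he, rfl⟩ := h
  obtain ⟨f, hf, rfl⟩ := h'
  refine ⟨e * crst (b * f), he.mul (isProj_crst _), ?_⟩
  rw [mul_assoc e (crst _), ← mul_assoc (crst _) b, ← mul_proj_eq b hf]
  simp only [mul_assoc]

/-- An element is thus determined by its plus and any upper bound; injectivity of `Fp.toIp` rests on
this. -/
theorem NatLE.eq_crst_mul {a b : S} (h : NatLE a b) : a = crst a * b := by
  obtain ⟨e, he, rfl⟩ := h
  rw [he.crst_mul_eq, mul_assoc, crst_mul]

theorem IsProj.natLE_one {e : S} (he : IsProj e) : NatLE e 1 := ⟨e, he, (mul_one e).symm⟩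

theorem NatLE.isProj {e : S} (h : NatLE e 1) : IsProj e := by
  obtain ⟨f, hf, rfl⟩ := h
  rwa [mul_one]

end BirestrictionMonoid

/-- The composition of morphisms of birestriction monoids. -/
def BirestrictionHom.comp {S : Type u} {T : Type v} {U : Type w} [BirestrictionMonoid S]
    [BirestrictionMonoid T] [BirestrictionMonoid U] (g : BirestrictionHom T U)
    (f : BirestrictionHom S T) : BirestrictionHom S U where
  toMonoidHom := g.toMonoidHom.comp f.toMonoidHom
  map_rst s := (congrArg g.toFun (f.map_rst s)).trans (g.map_rst _)
  map_crst s := (congrArg g.toFun (f.map_crst s)).trans (g.map_crst _)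

open BirestrictionMonoid in
theorem BirestrictionHom.eq_of_generated {Y S T : Type*} [BirestrictionMonoid S]
    [BirestrictionMonoid T] {ι : Y → S} (hι : BirestrictionMonoid.IsGeneratedBy ι)
    (f g : BirestrictionHom S T) (h : ∀ y, f.toFun (ι y) = g.toFun (ι y)) (s : S) :
    f.toFun s = g.toFun s := by
  refine hι {s | f.toFun s = g.toFun s} h (f.map_one'.trans g.map_one'.symm) ?_ ?_ ?_ s
  · intro a ha b hb
    exact (f.map_mul' a b).trans ((congrArg₂ (· * ·) ha hb).trans (g.map_mul' a b).symm)
  · intro a ha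
    exact (f.map_rst a).trans ((congrArg rst ha).trans (g.map_rst a).symm)
  · intro a ha
    exact (f.map_crst a).trans ((congrArg crst ha).trans (g.map_crst a).symm)

/-! ### Inversion and the natural order in inverse monoids. -/

namespace InverseMonoid

open BirestrictionMonoid

variable {T : Type u} [InverseMonoid T]

theorem rst_eq (a : T) : rst a = a⁻¹ * a := rfl

theorem crst_eq (a : T) : crst a = a * a⁻¹ := rfl

theorem inv_one : (1 : T)⁻¹ = 1 := by
  have := InverseMonoid.mul_inv (1 : T)⁻¹ 1
  rw [mul_one, inv_inv', mul_one] at this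
  exact this.symm

theorem inv_eq_of_isProj {e : T} (he : IsProj e) : e⁻¹ = e := by
  obtain ⟨a, rfl⟩ := he
  rw [rst_eq, InverseMonoid.mul_inv, inv_inv']

theorem natLE_inv {a b : T} (h : NatLE a b) : NatLE a⁻¹ b⁻¹ := by
  obtain ⟨e, he, rfl⟩ := h
  refine ⟨crst (b⁻¹ * e), isProj_crst _, ?_⟩
  rw [InverseMonoid.mul_inv, inv_eq_of_isProj he, ← mul_proj_eq _ he]

end InverseMonoid

/-! ### The symmetric inverse monoid and the Munn representation -/

namespace PEquiv

variable {α : Type u}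

theorem symm_trans_self_eq_some (f : α ≃. α) (a b : α) :
    f.symm.trans f a = some b ↔ a = b ∧ ∃ c, f c = some a := by
  rw [trans_eq_some]
  constructor
  · rintro ⟨c, hc, hb⟩
    rw [eq_some_iff] at hc
    exact ⟨Option.some_injective _ (hc.symm.trans hb), c, hc⟩
  · rintro ⟨rfl, c, hc⟩
    exact ⟨c, (eq_some_iff f).2 hc, hc⟩

theorem self_trans_symm_eq_some (f : α ≃. α) (a b : α) :
    f.trans f.symm a = some b ↔ a = b ∧ ∃ c, f a = some c := by
  have h := symm_trans_self_eq_some f.symm a b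
  rw [symm_symm] at h
  rw [h]
  simp only [eq_some_iff]

/-- The symmetric inverse monoid on `α`; products are composed from left to right. -/
instance : InverseMonoid (α ≃. α) where
  mul := PEquiv.trans
  one := PEquiv.refl α
  inv := PEquiv.symm
  mul_assoc := PEquiv.trans_assoc
  one_mul := PEquiv.refl_trans
  mul_one := PEquiv.trans_refl
  inv_inv' := PEquiv.symm_symm
  mul_inv := PEquiv.symm_trans_rev
  mul_inv_mul f := by
    refine PEquiv.ext fun a => Option.ext fun b => ?_
    change (f.trans f.symm).trans f a = some b ↔ _
    rw [trans_eq_some]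
    simp only [self_trans_symm_eq_some]
    constructor
    · rintro ⟨c, ⟨rfl, -⟩, h⟩
      exact h
    · exact fun h => ⟨a, ⟨rfl, b, h⟩, h⟩
  comm f g := by
    refine PEquiv.ext fun a => Option.ext fun b => ?_
    change (f.trans f.symm).trans (g.trans g.symm) a = some b ↔
      (g.trans g.symm).trans (f.trans f.symm) a = some b
    rw [trans_eq_some, trans_eq_some]
    simp only [self_trans_symm_eq_some]
    constructor
    · rintro ⟨c, ⟨rfl, h⟩, rfl, h'⟩
      exact ⟨a, ⟨rfl, h'⟩, rfl, h⟩
    · rintro ⟨c, ⟨rfl, h⟩, rfl, h'⟩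
      exact ⟨a, ⟨rfl, h'⟩, rfl, h⟩

end PEquiv

namespace BirestrictionMonoid

variable {S : Type u} [BirestrictionMonoid S]

open Classical in
/-- The action of `a` on projections by `e ↦ (e a)^*`, a bijection from the ideal generated by
`a^+` onto that generated by `a^*`. -/
noncomputable def munn (a : S) : {e : S // IsProj e} ≃. {e : S // IsProj e} where
  toFun e := if e.1 * crst a = e.1 then some ⟨rst (e.1 * a), isProj_rst _⟩ else none
  invFun f := if f.1 * rst a = f.1 then some ⟨crst (a * f.1), isProj_crst _⟩ else none
  inv := by
    rintro ⟨e, he⟩ ⟨f, hf⟩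
    simp only [Option.ite_none_right_eq_some, Option.some.injEq, Subtype.mk.injEq]
    constructor
    · rintro ⟨h, rfl⟩
      -- With e = (af)⁺, both claims follow from ea = af.
      rw [← crst_mul_crst, ← mul_proj_eq a hf, hf.rst_mul_eq, (isProj_rst a).comm hf]
      exact ⟨rfl, h⟩
    · rintro ⟨h, rfl⟩
      rw [(isProj_rst _).comm (isProj_rst a), ← rst_mul_rst, ← he.mul_eq, he.crst_mul_eq]
      exact ⟨rfl, h⟩

open Classical in
theorem munn_eq_some (a : S) (e f : {e : S // IsProj e}) :
    munn a e = some f ↔ e.1 * crst a = e.1 ∧ rst (e.1 * a) = f.1 := by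
  change (ite _ _ _) = some f ↔ _
  rw [Option.ite_none_right_eq_some, Option.some.injEq, Subtype.ext_iff]

open Classical in
theorem munn_symm_eq_some (a : S) (e f : {e : S // IsProj e}) :
    (munn a).symm e = some f ↔ e.1 * rst a = e.1 ∧ crst (a * e.1) = f.1 := by
  change (ite _ _ _) = some f ↔ _
  rw [Option.ite_none_right_eq_some, Option.some.injEq, Subtype.ext_iff]

variable (S) in
/-- The Munn representation of a birestriction monoid. -/
noncomputable def munnHom : BirestrictionHom S ({e : S // IsProj e} ≃. {e : S // IsProj e}) where
  toFun := munn
  map_one' := by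
    refine PEquiv.ext fun e => Option.ext fun f => ?_
    change _ ↔ some e = some f
    rw [munn_eq_some, crst_one, mul_one, e.2.rst_eq, Option.some.injEq, Subtype.ext_iff]
    exact ⟨And.right, fun h => ⟨rfl, h⟩⟩
  map_mul' a b := by
    refine PEquiv.ext fun e => Option.ext fun f => ?_
    change _ ↔ (munn a).trans (munn b) e = some f
    rw [PEquiv.trans_eq_some]
    simp only [munn_eq_some]
    have he := e.2
    rw [← he.crst_mul_eq, ← mul_assoc]
    constructor
    · rintro ⟨h, hf⟩
      -- Since (ea)⁺ fixes eab on the left, e = (eab)⁺ lies below (ea)⁺ = ea⁺, so e is in the domain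
      -- of the Munn map of a.
      have h1 : e.1 * crst a = e.1 := by
        have := crst_mul_crst (e.1 * a) (e.1 * a * b)
        rw [← mul_assoc, crst_mul, h, he.crst_mul_eq, mul_assoc, (isProj_crst a).comm he,
          ← mul_assoc, he.idem] at this
        exact this.symm
      refine ⟨⟨rst (e.1 * a), isProj_rst _⟩, ⟨h1, rfl⟩, ?_, ?_⟩
      · rw [← (isProj_crst b).rst_mul_eq, mul_crst, h, ← mul_assoc, he.idem]
      · rw [← hf, rst_mul_eq_rst_rst_mul (e.1 * a)]
    · rintro ⟨g, ⟨h1, h2⟩, h3, h4⟩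
      rw [← h2] at h3 h4
      refine ⟨?_, ?_⟩
      · have h5 : e.1 * a * crst b = e.1 * a := by
          conv_lhs => rw [← mul_rst (e.1 * a), mul_assoc, h3, mul_rst]
        rw [crst_mul_eq_crst_mul_crst, h5, he.crst_mul_eq, h1]
      · rw [rst_mul_eq_rst_rst_mul, h4]
  map_rst a := by
    refine PEquiv.ext fun e => Option.ext fun f => ?_
    change _ ↔ (munn a).symm.trans (munn a) e = some f
    rw [PEquiv.symm_trans_self_eq_some, munn_eq_some, crst_rst,
      (e.2.mul (isProj_rst a)).rst_eq, Subtype.ext_iff]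
    -- The range of the Munn map of a is the domain of its inverse, that is, the projections below
    -- a^*.
    simp only [← PEquiv.eq_some_iff (munn a), munn_symm_eq_some]
    constructor
    · rintro ⟨h, h'⟩
      exact ⟨h.symm.trans h', ⟨_, isProj_crst _⟩, h, rfl⟩
    · rintro ⟨h, c, hc, -⟩
      exact ⟨hc, hc.trans h⟩
  map_crst a := by
    refine PEquiv.ext fun e => Option.ext fun f => ?_
    change _ ↔ (munn a).trans (munn a).symm e = some f
    rw [PEquiv.self_trans_symm_eq_some, munn_eq_some, (isProj_crst a).crst_eq,
      (e.2.mul (isProj_crst a)).rst_eq, Subtype.ext_iff]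
    simp only [munn_eq_some]
    constructor
    · rintro ⟨h, h'⟩
      exact ⟨h.symm.trans h', ⟨_, isProj_rst _⟩, h, rfl⟩
    · rintro ⟨h, c, hc, -⟩
      exact ⟨hc, hc.trans h⟩

/-- The domain of the Munn map of a projection e consists of the projections below e, and e is its
largest element. Off the projections the representation need not be faithful. -/
theorem munn_injOn_isProj {e f : S} (he : IsProj e) (hf : IsProj f) (h : munn e = munn f) :
    e = f := by
  have key : ∀ {e f : S}, IsProj e → IsProj f → munn e = munn f → e * f = e := by
    intro e f he hf h
    have h1 : munn e ⟨e, he⟩ = some ⟨e, he⟩ := by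
      rw [munn_eq_some, he.crst_eq, he.idem]
      exact ⟨rfl, he.rst_eq⟩
    rw [h, munn_eq_some, hf.crst_eq] at h1
    exact h1.1
  rw [← key he hf h, he.comm hf, key hf he h.symm]

end BirestrictionMonoid

/-! ### Morphisms from presentations -/

namespace BRestr

open BirestrictionMonoid

variable {Y : Type u} {R : BRTerm Y → BRTerm Y → Prop} {S : Type v} [BirestrictionMonoid S]

/-- The value of a term under an assignment. -/
def eval (f : Y → S) : BRTerm Y → S
  | .var y => f y
  | .one => 1
  | .mul a b => eval f a * eval f b
  | .rst a => BirestrictionMonoid.rst (eval f a)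
  | .crst a => BirestrictionMonoid.crst (eval f a)

theorem eval_congr (f : Y → S) (hf : ∀ a b, R a b → eval f a = eval f b) {a b : BRTerm Y}
    (h : BRCongr R a b) : eval f a = eval f b := by
  induction h with
  | rel h => exact hf _ _ h
  | refl => rfl
  | symm _ ih => exact ih.symm
  | trans _ _ ih ih' => exact ih.trans ih'
  | mul _ _ ih ih' => simp only [eval, ih, ih']
  | rst _ ih => simp only [eval, ih]
  | crst _ ih => simp only [eval, ih]
  | mul_assoc => exact _root_.mul_assoc _ _ _
  | one_mul => exact _root_.one_mul _
  | mul_one => exact _root_.mul_one _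
  | mul_rst => exact BirestrictionMonoid.mul_rst _
  | rst_comm => exact BirestrictionMonoid.rst_comm _ _
  | rst_mul_rst => exact BirestrictionMonoid.rst_mul_rst _ _
  | rst_mul => exact BirestrictionMonoid.rst_mul _ _
  | crst_mul => exact BirestrictionMonoid.crst_mul _
  | crst_comm => exact BirestrictionMonoid.crst_comm _ _
  | crst_mul_crst => exact BirestrictionMonoid.crst_mul_crst _ _
  | mul_crst => exact BirestrictionMonoid.mul_crst _ _
  | rst_crst => exact BirestrictionMonoid.rst_crst _
  | crst_rst => exact BirestrictionMonoid.crst_rst _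

/-- The morphism from a presented birestriction monoid induced by an assignment that respects the
relations. -/
def lift (f : Y → S) (hf : ∀ a b, R a b → eval f a = eval f b) : BirestrictionHom (BRestr R) S where
  toFun := Quotient.lift (eval f) fun _ _ h => eval_congr f hf h
  map_one' := rfl
  map_mul' := by rintro ⟨a⟩ ⟨b⟩; rfl
  map_rst := by rintro ⟨a⟩; rfl
  map_crst := by rintro ⟨a⟩; rfl

theorem isGeneratedBy_of (R : BRTerm Y → BRTerm Y → Prop) : IsGeneratedBy (of R) := by
  rintro A hv h1 hm hr hc ⟨t⟩
  induction t with
  | var y => exact hv y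
  | one => exact h1
  | mul a b iha ihb => exact hm _ iha _ ihb
  | rst a ih => exact hr _ ih
  | crst a ih => exact hc _ ih

end BRestr

namespace InvPres

variable {Y : Type u} {R : InvTerm Y → InvTerm Y → Prop} {T : Type v} [InverseMonoid T]

/-- The canonical assignment map `Y → Inv⟨Y | R⟩`. -/
def of (R : InvTerm Y → InvTerm Y → Prop) (y : Y) : InvPres R :=
  Quotient.mk (InvSetoid R) (InvTerm.var y)

/-- The value of a term under an assignment. -/
def eval (f : Y → T) : InvTerm Y → T
  | .var y => f y
  | .one => 1
  | .mul a b => eval f a * eval f b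
  | .inv a => (eval f a)⁻¹

theorem eval_congr (f : Y → T) (hf : ∀ a b, R a b → eval f a = eval f b) {a b : InvTerm Y}
    (h : InvCongr R a b) : eval f a = eval f b := by
  induction h with
  | rel h => exact hf _ _ h
  | refl => rfl
  | symm _ ih => exact ih.symm
  | trans _ _ ih ih' => exact ih.trans ih'
  | mul _ _ ih ih' => simp only [eval, ih, ih']
  | inv _ ih => simp only [eval, ih]
  | mul_assoc => exact _root_.mul_assoc _ _ _
  | one_mul => exact _root_.one_mul _
  | mul_one => exact _root_.mul_one _
  | mul_inv_mul => exact InverseMonoid.mul_inv_mul _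
  | inv_inv => exact InverseMonoid.inv_inv' _
  | mul_inv => exact InverseMonoid.mul_inv _ _
  | comm => exact InverseMonoid.comm _ _

/-- The morphism from a presented inverse monoid induced by an assignment that respects the
relations. -/
def lift (f : Y → T) (hf : ∀ a b, R a b → eval f a = eval f b) : BirestrictionHom (InvPres R) T where
  toFun := Quotient.lift (eval f) fun _ _ h => eval_congr f hf h
  map_one' := rfl
  map_mul' := by rintro ⟨a⟩ ⟨b⟩; rfl
  map_rst := by rintro ⟨a⟩; rfl
  map_crst := by rintro ⟨a⟩; rfl

theorem isGeneratedBy_of (R : InvTerm Y → InvTerm Y → Prop) :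
    InverseMonoid.IsGeneratedBy (of R) := by
  rintro A hv h1 hm hi ⟨t⟩
  induction t with
  | var y => exact hv y
  | one => exact h1
  | mul a b iha ihb => exact hm _ iha _ ihb
  | inv a ih => exact hi _ ih

end InvPres

/-! ### `I_p` is `E`-unitary -/

/-- In a group 1 is the only projection. The instance makes the free group a target for the
universal property of `Ip X`. -/
instance FreeGroup.instInverseMonoid {X : Type u} : InverseMonoid (FreeGroup X) where
  toMonoid := inferInstance
  toInv := inferInstance
  mul_inv_mul x := by group
  inv_inv' := inv_inv
  mul_inv := mul_inv_rev
  comm x y := by group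

namespace InverseMonoid

open BirestrictionMonoid

variable {X : Type u} {T : Type v} [InverseMonoid T]

/-- The value in an inverse monoid of a word in letters and inverse letters. -/
def wordEval (f : X → T) (L : List (X × Bool)) : T :=
  (L.map fun p => cond p.2 (f p.1) (f p.1)⁻¹).prod

theorem wordEval_singleton_true (f : X → T) (x : X) : wordEval f [(x, true)] = f x := by
  simp [wordEval]

theorem wordEval_append (f : X → T) (L L' : List (X × Bool)) :
    wordEval f (L ++ L') = wordEval f L * wordEval f L' := by
  simp [wordEval]

theorem wordEval_invRev (f : X → T) (L : List (X × Bool)) :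
    wordEval f (FreeGroup.invRev L) = (wordEval f L)⁻¹ := by
  induction L with
  | nil => exact inv_one.symm
  | cons p L ih =>
    have h1 : FreeGroup.invRev (p :: L) = FreeGroup.invRev L ++ [(p.1, !p.2)] := by
      simp [FreeGroup.invRev]
    have h2 : wordEval f (p :: L) = cond p.2 (f p.1) (f p.1)⁻¹ * wordEval f L := by
      simp [wordEval]
    have h3 : wordEval f [(p.1, !p.2)] = (cond p.2 (f p.1) (f p.1)⁻¹)⁻¹ := by
      rcases p with ⟨x, _ | _⟩ <;> simp [wordEval, inv_inv']
    rw [h1, h2, wordEval_append, ih, h3, InverseMonoid.mul_inv]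

/-- A cancelled pair evaluates to a projection, which lies below 1, and the order is compatible with
products. -/
theorem natLE_wordEval_of_step (f : X → T) {L L' : List (X × Bool)} (h : FreeGroup.Red.Step L L') :
    NatLE (wordEval f L) (wordEval f L') := by
  obtain @⟨L₁, L₂, x, b⟩ := h
  have h2 : NatLE (wordEval f [(x, b), (x, !b)]) 1 := by
    refine IsProj.natLE_one ?_
    cases b
    · have : wordEval f [(x, false), (x, !false)] = rst (f x) := by simp [wordEval, rst_eq]
      rw [this]
      exact isProj_rst _
    · have : wordEval f [(x, true), (x, !true)] = crst (f x) := by simp [wordEval, crst_eq]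
      rw [this]
      exact isProj_crst _
  have h3 := ((NatLE.refl (wordEval f L₁)).mul h2).mul (NatLE.refl (wordEval f L₂))
  rw [_root_.mul_one, ← wordEval_append, ← wordEval_append, ← wordEval_append] at h3
  simpa using h3

theorem natLE_wordEval_of_red (f : X → T) {L L' : List (X × Bool)} (h : FreeGroup.Red L L') :
    NatLE (wordEval f L) (wordEval f L') := by
  induction h with
  | refl => exact NatLE.refl _
  | tail _ h ih => exact ih.trans (natLE_wordEval_of_step f h)

end InverseMonoid

namespace Ip

open BirestrictionMonoid InverseMonoid

variable {X : Type u}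

theorem of_inl (x : X) : InvPres.of (IpRel X) (.inl x) =
    InvPres.of (IpRel X) (.inr x) * rst (InvPres.of (IpRel X) (.inl x)) :=
  Quotient.sound (InvCongr.rel (IpRel.ge x))

variable (X) in
/-- The maximum group image of `I_p`. -/
def toFreeGroup : BirestrictionHom (Ip X) (FreeGroup X) :=
  InvPres.lift (Sum.elim FreeGroup.of FreeGroup.of) (by
    rintro _ _ ⟨x⟩
    simp [InvPres.eval])

/-- Replacing every x by the larger bar x only increases a term, as the order respects products and
inverses, and it does not change the image in the free group. -/
theorem exists_natLE_wordEval (s : Ip X) : ∃ L : List (X × Bool),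
    NatLE s (wordEval (fun x => InvPres.of (IpRel X) (.inr x)) L) ∧
      (toFreeGroup X).toFun s = FreeGroup.mk L := by
  obtain ⟨t⟩ := s
  induction t with
  | var y =>
    rcases y with x | x
    · refine ⟨[(x, true)], ?_, rfl⟩
      have h : NatLE (InvPres.of (IpRel X) (.inl x)) (InvPres.of (IpRel X) (.inr x)) := by
        refine ⟨_, isProj_crst _, (of_inl x).trans (mul_proj_eq _ (isProj_rst _))⟩
      rwa [← wordEval_singleton_true fun x => InvPres.of (IpRel X) (.inr x)] at h
    · refine ⟨[(x, true)], ?_, rfl⟩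
      have h := NatLE.refl (InvPres.of (IpRel X) (.inr x))
      conv at h => rhs; rw [← wordEval_singleton_true fun x => InvPres.of (IpRel X) (.inr x)]
      exact h
  | one => exact ⟨[], NatLE.refl _, rfl⟩
  | mul a b iha ihb =>
    obtain ⟨L, hL, h⟩ := iha
    obtain ⟨L', hL', h'⟩ := ihb
    refine ⟨L ++ L', ?_, ?_⟩
    · rw [wordEval_append]
      exact hL.mul hL'
    · rw [← FreeGroup.mul_mk, ← h, ← h']
      rfl
  | inv a ih =>
    obtain ⟨L, hL, h⟩ := ih
    refine ⟨FreeGroup.invRev L, ?_, ?_⟩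
    · rw [wordEval_invRev]
      exact natLE_inv hL
    · rw [← FreeGroup.inv_mk, ← h]
      rfl

theorem isProj_of_toFreeGroup_eq_one {s : Ip X} (h : (toFreeGroup X).toFun s = 1) : IsProj s := by
  obtain ⟨L, hL, h'⟩ := exists_natLE_wordEval s
  rw [h, FreeGroup.one_eq_mk, FreeGroup.Red.exact] at h'
  obtain ⟨L', h1, h2⟩ := h'
  rw [FreeGroup.Red.nil_iff] at h1
  subst h1
  exact (hL.trans (natLE_wordEval_of_red _ h2)).isProj

-- Idempotents map to 1 in a group, hence so does everything above them; conversely only projections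
-- map to 1.
variable (X) in
theorem isEUnitary : IsEUnitary (Ip X) := by
  have key : ∀ e : Ip X, IsIdempotentElem e → (toFreeGroup X).toFun e = 1 := by
    intro e he
    have h := (toFreeGroup X).map_mul' e e
    rw [he.eq] at h
    exact mul_eq_left.1 h.symm
  intro e f s he hf h
  refine (isProj_of_toFreeGroup_eq_one ?_).idem
  have h' := (toFreeGroup X).map_mul' f s
  rwa [← h, key e he, key f hf, _root_.one_mul, eq_comm] at h'

end Ip

/-! ### The embedding of `F_p` into `I_p` -/

/-- Positive words are reduced, so two of them with the same image coincide. -/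
theorem FreeMonoid.lift_freeGroup_of_injective (X : Type u) :
    Function.Injective (FreeMonoid.lift (FreeGroup.of (α := X))) := by
  have hmk : ∀ w : FreeMonoid X, FreeMonoid.lift FreeGroup.of w =
      FreeGroup.mk (w.toList.map fun x => (x, true)) := by
    intro w
    induction w using FreeMonoid.inductionOn' with
    | one => rfl
    | of_mul x w ih =>
      rw [map_mul, ih]
      rfl
  have hred : ∀ l : List X, FreeGroup.IsReduced (l.map fun x => (x, true)) := by
    intro l
    refine List.Pairwise.isChain (List.pairwise_map.2 ?_)
    exact List.Pairwise.imp (fun _ _ => rfl) (List.pairwise_of_forall (R := fun _ _ => True)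
      (fun _ _ => trivial))
  intro v w h
  rw [hmk, hmk, FreeGroup.Red.exact] at h
  obtain ⟨L, h1, h2⟩ := h
  rw [(hred _).red_iff_eq] at h1 h2
  have h3 : Function.Injective fun x : X => (x, true) := fun x y h => congrArg Prod.fst h
  exact FreeMonoid.toList.injective (List.map_injective_iff.2 h3 (h1.symm.trans h2))

/-- Every free monoid is a birestriction monoid with a single projection. -/
instance FreeMonoid.instBirestrictionMonoid {X : Type u} : BirestrictionMonoid (FreeMonoid X) where
  toMonoid := inferInstance
  rst _ := 1
  crst _ := 1
  mul_rst x := mul_one x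
  rst_comm _ _ := rfl
  rst_mul_rst _ _ := rfl
  rst_mul _ y := (one_mul y).trans (mul_one y).symm
  crst_mul x := one_mul x
  crst_comm _ _ := rfl
  crst_mul_crst _ _ := rfl
  mul_crst x _ := (mul_one x).trans (one_mul x).symm
  rst_crst _ := rfl
  crst_rst _ := rfl

namespace Fp

open BirestrictionMonoid

variable {X : Type u}

theorem of_inl (x : X) : BRestr.of (FpRel X) (.inl x) =
    BRestr.of (FpRel X) (.inr x) * rst (BRestr.of (FpRel X) (.inl x)) :=
  Quotient.sound (BRCongr.rel (FpRel.ge x))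

variable (X) in
/-- The canonical morphism `F_p → I_p`. -/
def toIp : BirestrictionHom (Fp X) (Ip X) :=
  BRestr.lift (InvPres.of (IpRel X)) (by
    rintro _ _ ⟨x⟩
    exact Ip.of_inl x)

variable (X) in
/-- The quotient of `F_p` by `σ`. -/
def weight : BirestrictionHom (Fp X) (FreeMonoid X) :=
  BRestr.lift (Sum.elim FreeMonoid.of FreeMonoid.of) (by
    rintro _ _ ⟨x⟩
    exact (_root_.mul_one _).symm)

variable (X) in
/-- The product of the barred letters of a word. -/
def bar : FreeMonoid X →* Fp X := FreeMonoid.lift fun x => BRestr.of (FpRel X) (.inr x)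

/-- By induction on generation: x lies below bar x, products respect the order, and projections have
weight 1 and lie below 1. Hence bar(w) dominates every element of weight w. -/
theorem natLE_bar_weight (s : Fp X) : NatLE s (bar X ((weight X).toFun s)) := by
  refine BRestr.isGeneratedBy_of (FpRel X)
    {s | NatLE s (bar X ((weight X).toFun s))} ?_ ?_ ?_ ?_ ?_ s
  · rintro (x | x)
    · exact ⟨_, isProj_crst _, (of_inl x).trans (mul_proj_eq _ (isProj_rst _))⟩
    · exact NatLE.refl _
  · exact NatLE.refl _
  · intro s hs t ht
    have h : bar X ((weight X).toFun (s * t)) = _ :=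
      (congrArg (bar X) ((weight X).map_mul' s t)).trans (map_mul _ _ _)
    rw [Set.mem_ofPred_eq, h]
    exact NatLE.mul hs ht
  · intro s _
    rw [Set.mem_ofPred_eq, (weight X).map_rst]
    exact (isProj_rst s).natLE_one
  · intro s _
    rw [Set.mem_ofPred_eq, (weight X).map_crst]
    exact (isProj_crst s).natLE_one

/-- Agreement on generators suffices; this is how the weight is read off from the image in `Ip X`.
-/
theorem toFreeGroup_toIp (s : Fp X) : (Ip.toFreeGroup X).toFun ((toIp X).toFun s) =
    FreeMonoid.lift FreeGroup.of ((weight X).toFun s) := by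
  let f : BirestrictionHom (FreeMonoid X) (FreeGroup X) :=
    { toMonoidHom := FreeMonoid.lift FreeGroup.of
      map_rst := fun w => (map_one (FreeMonoid.lift FreeGroup.of)).trans (inv_mul_cancel _).symm
      map_crst := fun w => (map_one (FreeMonoid.lift FreeGroup.of)).trans (mul_inv_cancel _).symm }
  refine BirestrictionHom.eq_of_generated (BRestr.isGeneratedBy_of (FpRel X))
    ((Ip.toFreeGroup X).comp (toIp X)) (f.comp (weight X)) ?_ s
  rintro (x | x) <;> rfl

variable (X) in
/-- The Munn representation of `F_p` factors through `I_p`. -/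
noncomputable def ipToMunn :
    BirestrictionHom (Ip X) ({e : Fp X // IsProj e} ≃. {e : Fp X // IsProj e}) :=
  InvPres.lift (fun y => munn (BRestr.of (FpRel X) y)) (by
    rintro _ _ ⟨x⟩
    have h := congrArg munn (of_inl x)
    refine h.trans (((munnHom (Fp X)).map_mul' _ _).trans ?_)
    exact congrArg (_ * ·) ((munnHom (Fp X)).map_rst _))

theorem ipToMunn_toIp (s : Fp X) : (ipToMunn X).toFun ((toIp X).toFun s) = munn s :=
  BirestrictionHom.eq_of_generated (BRestr.isGeneratedBy_of (FpRel X))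
    ((ipToMunn X).comp (toIp X)) (munnHom (Fp X)) (fun _ => rfl) s

-- The image determines the weight through the free group and s⁺ through the Munn representation,
-- and s is s⁺ times the barred weight.
variable (X) in
theorem toIp_injective : Function.Injective (toIp X).toFun := by
  intro s t h
  have hw : (weight X).toFun s = (weight X).toFun t := by
    apply FreeMonoid.lift_freeGroup_of_injective
    rw [← toFreeGroup_toIp, ← toFreeGroup_toIp, h]
  have hc : crst s = crst t := by
    refine munn_injOn_isProj (isProj_crst s) (isProj_crst t) ?_
    rw [← ipToMunn_toIp, ← ipToMunn_toIp, (toIp X).map_crst, (toIp X).map_crst, h]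
  rw [(natLE_bar_weight s).eq_crst_mul, (natLE_bar_weight t).eq_crst_mul, hc, hw]

/-! ### Maxima of the σ-classes of `Fp X`. -/

theorem weight_eq_one {e : Fp X} (he : IsProj e) : (weight X).toFun e = 1 := by
  obtain ⟨a, rfl⟩ := he
  exact (weight X).map_rst a

theorem weight_eq_of_sigma {s t : Fp X} (h : Sigma s t) :
    (weight X).toFun s = (weight X).toFun t := by
  obtain ⟨e, he, h⟩ := h
  have h' := congrArg (weight X).toFun h
  have hs := (weight X).map_mul' e s
  have ht := (weight X).map_mul' e t
  rw [weight_eq_one he, _root_.one_mul] at hs ht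
  exact hs.symm.trans (h'.trans ht)

/-- `F_p` is a perfect `F`-birestriction monoid. -/
instance : PerfectFBirestrictionMonoid (Fp X) where
  mx s := bar X ((weight X).toFun s)
  mx_sigma s := ⟨crst s, isProj_crst s, by
    rw [← (natLE_bar_weight s).eq_crst_mul, crst_mul]⟩
  le_mx s t h := by
    rw [← weight_eq_of_sigma h]
    exact natLE_bar_weight t
  mx_one := (congrArg (bar X) (weight X).map_one').trans (map_one _)
  mx_mul s t := (congrArg (bar X) ((weight X).map_mul' s t)).trans (map_mul _ _ _)

end Fp

/-! ### Geometric models -/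

open BirestrictionMonoid in
/-- A birestriction monoid whose generators are fixed by a composition through `F_p` admits a
geometric model, provided that the images of the generators in `F_p` include those of `F_p`. -/
theorem AdmitsGeometricModel.of_retraction {X Y S : Type u} [BirestrictionMonoid S] {ι : Y → S}
    (hι : BirestrictionMonoid.IsGeneratedBy ι) (g : BirestrictionHom S (Fp X))
    (h : BirestrictionHom (Fp X) S) (hgh : ∀ s, h.toFun (g.toFun s) = s)
    (hg : ∀ y, ∃ z, g.toFun (ι z) = BRestr.of (FpRel X) y) : AdmitsGeometricModel ι := by
  refine ⟨hι, Ip X, inferInstance, fun y => (Fp.toIp X).toFun (g.toFun (ι y)), (Fp.toIp X).comp g,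
    ?_, Ip.isEUnitary X, ?_, fun y => rfl⟩
  · intro A hA
    refine InvPres.isGeneratedBy_of (IpRel X) A fun y => ?_
    obtain ⟨z, hz⟩ := hg y
    exact (congrArg (fun s => (Fp.toIp X).toFun s ∈ A) hz).mp (hA z)
  · exact (Fp.toIp_injective X).comp (Function.LeftInverse.injective hgh)

theorem BirestrictionHom.leftInverse_of_generated {Y S T : Type*} [BirestrictionMonoid S]
    [BirestrictionMonoid T] {ι : Y → S} (hι : BirestrictionMonoid.IsGeneratedBy ι)
    (g : BirestrictionHom S T) (h : BirestrictionHom T S)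
    (hgh : ∀ y, h.toFun (g.toFun (ι y)) = ι y) (s : S) : h.toFun (g.toFun s) = s :=
  BirestrictionHom.eq_of_generated hι (h.comp g)
    { toMonoidHom := MonoidHom.id S, map_rst := fun _ => rfl, map_crst := fun _ => rfl } hgh s

namespace CalFp

open BirestrictionMonoid

variable (X : Type u)

/-- The canonical morphism `𝓕_p → F_p`. -/
def toFp : BirestrictionHom (CalFp X) (Fp X) :=
  BRestr.lift (Sum.elim (fun x => BRestr.of (FpRel X) (.inl x))
    (FreeSemigroup.lift fun x => BRestr.of (FpRel X) (.inr x))) (by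
    rintro _ _ (x | ⟨p, q⟩)
    · exact Fp.of_inl x
    · exact map_mul _ p q)

/-- The canonical morphism `F_p → 𝓕_p`. -/
def ofFp : BirestrictionHom (Fp X) (CalFp X) :=
  BRestr.lift (Sum.elim (fun x => BRestr.of (CalFpRel X) (.inl x))
    fun x => BRestr.of (CalFpRel X) (.inr (FreeSemigroup.of x))) (by
    rintro _ _ ⟨x⟩
    exact Quotient.sound (BRCongr.rel (CalFpRel.ge x)))

theorem ofFp_toFp (s : CalFp X) : (ofFp X).toFun ((toFp X).toFun s) = s := by
  refine BirestrictionHom.leftInverse_of_generated (BRestr.isGeneratedBy_of (CalFpRel X)) _ _ ?_ s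
  rintro (x | p)
  · rfl
  · induction p with
    | ih1 x => rfl
    | ih2 x p hx hp =>
      -- The multiplicativity relation splits off the first letter of a barred word.
      have h : BRestr.of (CalFpRel X) (.inr (FreeSemigroup.of x * p)) =
          BRestr.of (CalFpRel X) (.inr (FreeSemigroup.of x)) * BRestr.of (CalFpRel X) (.inr p) :=
        Quotient.sound (BRCongr.rel (CalFpRel.mul _ _))
      have h' := ((ofFp X).comp (toFp X)).map_mul' (BRestr.of (CalFpRel X) (.inr (FreeSemigroup.of x)))
        (BRestr.of (CalFpRel X) (.inr p))
      rw [← h] at h'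
      refine h'.trans ((congrArg₂ (· * ·) hx hp).trans h.symm)

end CalFp

/-! ### The free perfect F-birestriction monoid as a retract of `Fp X`. -/

namespace FFBRp

open BirestrictionMonoid FBirestrictionMonoid PerfectFBirestrictionMonoid

variable (X : Type u)

theorem isGeneratedBy_assign : IsGeneratedBy (assign (X := X)) := by
  intro A hv h1 hm hr hc s
  -- A need not be closed under `mx`, so the induction carries `mx s` along: `mx` is multiplicative,
  -- idempotent, and 1 on projections.
  suffices h : s ∈ A ∧ mx s ∈ A from h.1
  have mx_rst' : ∀ a : FFBRp X, mx (rst a) = 1 := by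
    intro a
    have := mx_rst (1 : FFBRp X) a
    rwa [_root_.one_mul, mx_one] at this
  obtain ⟨t, rfl⟩ : ∃ t : FTerm X, s = Quotient.mk (FTermSetoid X) t := by
    obtain ⟨t⟩ := s
    exact ⟨t, rfl⟩
  induction t with
  | var x => exact ⟨hv (.inl x), hv (.inr x)⟩
  | one => exact ⟨h1, mx_one (S := FFBRp X) ▸ h1⟩
  | mul a b iha ihb =>
    have h := mx_mul (S := FFBRp X) (Quotient.mk (FTermSetoid X) a) (Quotient.mk (FTermSetoid X) b)
    exact ⟨hm _ iha.1 _ ihb.1, (congrArg (· ∈ A) h).mpr (hm _ iha.2 _ ihb.2)⟩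
  | rst a ih =>
    have h := mx_rst' (Quotient.mk (FTermSetoid X) a)
    exact ⟨hr _ ih.1, (congrArg (· ∈ A) h).mpr h1⟩
  | crst a ih =>
    have h := mx_rst' (crst (S := FFBRp X) (Quotient.mk (FTermSetoid X) a))
    have h' := rst_crst (S := FFBRp X) (Quotient.mk (FTermSetoid X) a)
    exact ⟨hc _ ih.1, (congrArg (· ∈ A) ((congrArg mx h').symm.trans h)).mpr h1⟩
  | mx a ih =>
    have h := mx_eq_of_sigma (mx_sigma (S := FFBRp X) (Quotient.mk (FTermSetoid X) a))
    exact ⟨ih.2, (congrArg (· ∈ A) h).mpr ih.2⟩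

theorem isGeneratedBy_assignPlus : IsGeneratedBy (assignPlus (X := X)) := by
  intro A hv
  refine isGeneratedBy_assign X A ?_
  rintro (x | x)
  · exact hv (.inl x)
  · exact hv (.inr (FreeSemigroup.of x))

/-- The canonical morphism `F_p → FFBR_p(X)`. -/
def ofFp : BirestrictionHom (Fp X) (FFBRp X) :=
  BRestr.lift (assign (X := X)) (by
    rintro _ _ ⟨x⟩
    exact (mx_mul_rst (of x)).symm)

/-- Freeness applies because `Fp X` is a perfect F-birestriction monoid, in which the maximum above
x is bar x. -/
theorem exists_toFp : ∃ g : BirestrictionHom (FFBRp X) (Fp X),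
    (∀ y, g.toFun (assign y) = BRestr.of (FpRel X) y) ∧
      ∀ s, (ofFp X).toFun (g.toFun s) = s := by
  obtain ⟨g, ⟨hm, hx⟩, -⟩ := existsUnique_lift fun x : X => BRestr.of (FpRel X) (.inl x)
  have hg : ∀ y, g.toFun (assign y) = BRestr.of (FpRel X) y := by
    rintro (x | x)
    · exact hx x
    · exact (hm (of x)).trans (congrArg mx (hx x))
  refine ⟨g, hg, BirestrictionHom.leftInverse_of_generated (isGeneratedBy_assign X) _ _ fun y => ?_⟩
  rw [hg]
  rfl

end FFBRp

theorem mainTheorem9 (X : Type u) [Nonempty X] :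
    InverseMonoid.IsEUnitary (Ip X) ∧
    AdmitsGeometricModel (BRestr.of (FpRel X)) ∧
    AdmitsGeometricModel (BRestr.of (CalFpRel X)) ∧
    AdmitsGeometricModel (FFBRp.assign (X := X)) ∧
    AdmitsGeometricModel (FFBRp.assignPlus (X := X)) := by
  obtain ⟨g, hg, hs⟩ := FFBRp.exists_toFp X
  refine ⟨Ip.isEUnitary X, ?_, ?_, ?_, ?_⟩
  · exact ⟨BRestr.isGeneratedBy_of _, Ip X, inferInstance, InvPres.of (IpRel X), Fp.toIp X,
      InvPres.isGeneratedBy_of _, Ip.isEUnitary X, Fp.toIp_injective X, fun _ => rfl⟩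
  · refine .of_retraction (BRestr.isGeneratedBy_of _) (CalFp.toFp X) (CalFp.ofFp X)
      (CalFp.ofFp_toFp X) ?_
    rintro (x | x)
    · exact ⟨.inl x, rfl⟩
    · exact ⟨.inr (FreeSemigroup.of x), rfl⟩
  · exact .of_retraction (FFBRp.isGeneratedBy_assign X) g (FFBRp.ofFp X) hs fun y => ⟨y, hg y⟩
  · refine .of_retraction (FFBRp.isGeneratedBy_assignPlus X) g (FFBRp.ofFp X) hs ?_
    rintro (x | x)
    · exact ⟨.inl x, hg (.inl x)⟩
    · exact ⟨.inr (FreeSemigroup.of x), hg (.inr x)⟩
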